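/- Let $R$ be a unital, associative (not necessarily commutative) ring such that (i) $R$ is an exchange ring: for every right $R$-module $M$ and all internal direct sum decompositions $M=M'\oplus N=M_1\oplus\dots\oplus M_m$ with $M'\cong R_R$, there are submodules $M_i'\subseteq M_i$ such that $M=M'\oplus M_1'\oplus\dots\oplus M_m'$; (ii) $R$ is separative: for all finitely generated projective right $R$-modules $P$ and $Q$, if $P\oplus P\cong P\oplus Q\cong Q\oplus Q$, then $P\cong Q$. Let $A$ be an $n\times n$ matrix over $R$ that is von Neumann regular, i.e. $AXA=A$ for some $n\times n$ matrix $X$ over $R$. Then $A$ can be transformed into a diagonal matrix by a finite sequence of elementary row and column operations, where an elementary row (respectively, column) operation adds a left (respectively, right) multiple of one row (respectively, column) to a different row (respectively, column). -/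

import Mathlib

universe u

/-- A module `M` over a ring `S` has the finite exchange property if, for every `S`-module `A` and
all internal decompositions `A = M' ⊕ N = A₁ ⊕ ⋯ ⊕ Aₙ` with `M' ≅ M`, there are submodules
`A'ᵢ ⊆ Aᵢ` such that `A = M' ⊕ A'₁ ⊕ ⋯ ⊕ A'ₙ`. -/
def HasFiniteExchange (S : Type u) [Ring S] (M : Type u) [AddCommGroup M] [Module S M] : Prop :=
  ∀ (A : Type u) [AddCommGroup A] [Module S A] (M' N : Submodule S A) (n : ℕ)
    (B : Fin n → Submodule S A),
    Nonempty (M' ≃ₗ[S] M) → IsCompl M' N → DirectSum.IsInternal B →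
      ∃ B' : Fin n → Submodule S A, (∀ i, B' i ≤ B i) ∧
        DirectSum.IsInternal (Fin.cons M' B' : Fin (n + 1) → Submodule S A)

/-- `R` is an exchange ring if `R`, as a right module over itself (that is, as a module over
`Rᵐᵒᵖ`), has the finite exchange property. -/
def IsExchangeRing (R : Type u) [Ring R] : Prop :=
  HasFiniteExchange Rᵐᵒᵖ R

/-- `R` is separative if `A ⊕ A ≅ A ⊕ B ≅ B ⊕ B` implies `A ≅ B` for all finitely generated
projective right `R`-modules `A` and `B`. -/
def IsSeparativeRing (R : Type u) [Ring R] : Prop :=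
  ∀ (A B : Type u) [AddCommGroup A] [AddCommGroup B] [Module Rᵐᵒᵖ A] [Module Rᵐᵒᵖ B]
    [Module.Finite Rᵐᵒᵖ A] [Module.Finite Rᵐᵒᵖ B]
    [Module.Projective Rᵐᵒᵖ A] [Module.Projective Rᵐᵒᵖ B],
    Nonempty ((A × A) ≃ₗ[Rᵐᵒᵖ] (A × B)) → Nonempty ((A × B) ≃ₗ[Rᵐᵒᵖ] (B × B)) →
      Nonempty (A ≃ₗ[Rᵐᵒᵖ] B)

/-- `a` is von Neumann regular if `a = a x a` for some `x`. -/
def IsVonNeumannRegular {S : Type u} [Mul S] (a : S) : Prop :=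
  ∃ x : S, a * x * a = a

/-- `ElementaryOperation A B`: the matrix `B` arises from `A` by one elementary operation, i.e.
by adding a left multiple of one row to a different row, or a right multiple of one column to a
different column. -/
inductive ElementaryOperation {R : Type u} [Ring R] {n : ℕ} (A : Matrix (Fin n) (Fin n) R) :
    Matrix (Fin n) (Fin n) R → Prop
  | row (i j : Fin n) (hij : i ≠ j) (r : R) :
      ElementaryOperation A (A.updateRow i (fun k => A i k + r * A j k))
  | col (i j : Fin n) (hij : i ≠ j) (r : R) :
      ElementaryOperation A (A.updateCol i (fun k => A k i + A k j * r))

/-!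
A regular matrix `A` over `R` is an endomorphism of the right module `Rⁿ = R ⊕ Rⁿ⁻¹` (`n ≥ 2`) that
restricts to an isomorphism from a complement of its kernel `K` onto its image `I`, and `I` has a
complement `L`. It suffices to bring `A` into block diagonal form with respect to `R ⊕ Rⁿ⁻¹`, since
the lower block is again regular and induction applies. Two facts achieve this; each is a
computation in the monoid `V(R)` of isomorphism classes of finitely generated projective modules,
which has refinement because `R` is an exchange ring, combined with separative cancellation
(`IsSeparative.cancel`): `a + c = b + c` implies `a = b` if `c` lies in the order ideals generated
by `a` and by `b`.

* Block diagonal form up to automorphisms of the domain and the codomain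
  (`exists_equiv_block_diagonal`). This asks for splittings `K = K₁ ⊕ K₂`, `I = I₁ ⊕ I₂`,
  `L = L₁ ⊕ L₂` with `K₁ ⊕ I₁ ≅ R ≅ L₁ ⊕ I₁` and `K₂ ⊕ I₂ ≅ Rⁿ⁻¹ ≅ L₂ ⊕ I₂`. They exist by
  `IsSeparative.exists_compatible_splitting`: starting from a splitting for `K` and `I`, a summand
  common to `K₁` and `I₂` is interchanged so that `I₂` comes to lie in the order ideal of `I₁`. Then
  `I₂` can be cancelled from `K ⊕ I ≅ L ⊕ I`, and a refinement of what remains yields the splitting.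

* Every automorphism `θ` of `R ⊕ Rⁿ⁻¹` is a diagonal one up to a product of shears, hence of
  elementary matrices (`exists_shear_diagonalizing`). Shears replace one member of a pair of
  complementary submodules by any other complement of the other member
  (`ShearReachable.replace_left`, `ShearReachable.replace_right`), so the claim is that the
  coordinate pair can be moved to its image under `θ⁻¹` by such replacements. By the exchange
  property that image may be taken to be compatible with the coordinates, say
  `(X₁ ⊕ Y₁, X₂ ⊕ Y₂)` with `R = X₁ ⊕ X₂` and `Rⁿ⁻¹ = Y₁ ⊕ Y₂`. Isomorphic summands on the two sides
  can be interchanged through the graph of an isomorphism (`ShearReachable.swap`). If `X₂ ≅ Y₁`,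
  one such interchange suffices. In general `X₂ ⊕ X₁ ≅ Y₁ ⊕ X₁`, and interchanging a common summand
  of `X₁` and `Y₂` first enlarges `X₂` and `Y₁` until `X₁` can be cancelled
  (`IsSeparative.exists_add_eq_add`).

The exchange property enters as `HasInvariantSections`, a form that passes to products and to direct
summands by short computations with maps.
-/

/-! ### Separative refinement monoids -/

section Monoid

variable {V : Type*} [AddCommMonoid V]

/-- The Riesz refinement property of a commutative monoid: any two decompositions of an element
into two summands have a common refinement. -/
def HasRefinement (V : Type*) [AddCommMonoid V] : Prop :=
  ∀ a b c d : V, a + b = c + d → ∃ w x y z, a = w + x ∧ b = y + z ∧ c = w + y ∧ d = x + z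

/-- A commutative monoid is separative if `2a = a + b = 2b` implies `a = b`. -/
def IsSeparative (V : Type*) [AddCommMonoid V] : Prop :=
  ∀ a b : V, a + a = a + b → a + b = b + b → a = b

/-- `y` lies in the order ideal generated by `z`, for the algebraic preorder of the monoid. -/
def Below (y z : V) : Prop :=
  ∃ (m : ℕ) (t : V), y + t = m • z

theorem Below.of_add_eq {y t z : V} (h : y + t = z) : Below y z :=
  ⟨1, t, by rw [h, one_smul]⟩

theorem Below.trans {x y z : V} (h₁ : Below x y) (h₂ : Below y z) : Below x z := by
  obtain ⟨m, s, hs⟩ := h₁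
  obtain ⟨k, t, ht⟩ := h₂
  exact ⟨m * k, s + m • t, by rw [← add_assoc, hs, ← smul_add, ht, mul_smul]⟩

theorem Below.add {x y z : V} (h₁ : Below x z) (h₂ : Below y z) : Below (x + y) z := by
  obtain ⟨m, s, hs⟩ := h₁
  obtain ⟨k, t, ht⟩ := h₂
  exact ⟨m + k, s + t, by rw [add_smul, ← hs, ← ht]; abel⟩

theorem Below.left (x y : V) : Below x (x + y) := .of_add_eq rfl

theorem Below.right (x y : V) : Below y (x + y) := .of_add_eq (add_comm y x)

theorem Below.nsmul (m : ℕ) (x : V) : Below (m • x) x := ⟨m, 0, add_zero _⟩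

/-- One step of the descent in `IsSeparative.cancel`: the elements `(k + 1)a + a` and `(k + 1)a + b`
satisfy the hypotheses of separativity. -/
theorem IsSeparative.descend (hsep : IsSeparative V) {a b : V} {k : ℕ}
    (h : (k + 2) • a + a = (k + 2) • a + b) : (k + 1) • a + a = (k + 1) • a + b := by
  have e : (k + 2) • a = (k + 1) • a + a := succ_nsmul a (k + 1)
  have e' : (k + 1) • a = k • a + a := succ_nsmul a k
  refine hsep _ _ ?_ ?_
  · calc (k + 1) • a + a + ((k + 1) • a + a) = (k + 1) • a + ((k + 2) • a + a) := by
          rw [e]; abel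
      _ = (k + 1) • a + a + ((k + 1) • a + b) := by rw [h, e]; abel
  · calc (k + 1) • a + a + ((k + 1) • a + b) = k • a + ((k + 2) • a + a) + b := by
          rw [e, e']; abel
      _ = (k + 1) • a + b + ((k + 1) • a + b) := by rw [h, e, e']; abel

/-- Separative cancellation: a summand may be cancelled when it lies in the order ideals generated
by both remaining terms. -/
theorem IsSeparative.cancel (hsep : IsSeparative V) {a b c : V} (h : a + c = b + c)
    (ha : Below c a) (hb : Below c b) : a = b := by
  -- Adding a complement of `c` in a multiple of `a` gives `(m + 1)a + a = (m + 1)a + b`, and the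
  -- multiplicity is lowered step by step.
  have key : ∀ {a b : V}, a + c = b + c → Below c a → a + a = a + b := by
    rintro a b h ⟨m, t, ht⟩
    have h1 : (m + 1) • a + a = (m + 1) • a + b := by
      rw [succ_nsmul, ← ht]
      calc c + t + a + a = (a + c) + (t + a) := by abel
        _ = c + t + a + b := by rw [h]; abel
    clear ht
    induction m with
    | zero => simpa using h1
    | succ m ih => exact ih (hsep.descend h1)
  refine hsep a b (key h ha) ?_
  rw [key h.symm hb, add_comm]

/-- If `y` is dominated by multiples of `a` modulo `w`, then `y` and `a` share a summand `x` such
that the rest of `y` lies in the order ideal of `x + w`. -/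
theorem HasRefinement.exists_common_summand (href : HasRefinement V) (a w : V) (m : ℕ) :
    ∀ y r : V, y + r = m • a + w →
      ∃ x y' a', y = x + y' ∧ a = x + a' ∧ Below y' (x + w) := by
  induction m with
  | zero =>
    intro y r h
    exact ⟨0, y, a, by simp, by simp, .of_add_eq (t := r) (by simpa using h)⟩
  | succ m ih =>
    intro y r h
    obtain ⟨y₁, y₂, r₁, r₂, rfl, -, h₁, h₂⟩ :=
      href y r a (m • a + w) (by rw [h, succ_nsmul]; abel)
    obtain ⟨x, y', a', rfl, ha', hB⟩ := ih y₂ r₂ h₂.symm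
    -- The part of `y₁` that overlaps with `x` inside `a` is already dominated by `x`.
    obtain ⟨s, t, s', t', rfl, -, hx, rfl⟩ := href y₁ r₁ x a' (h₁.symm.trans ha')
    refine ⟨x + t, s + y', t', by abel, by rw [ha', add_assoc], .add ?_ ?_⟩
    · exact .trans (.of_add_eq hx.symm) (by rw [add_assoc]; exact .left _ _)
    · exact hB.trans (.of_add_eq (t := t) (by abel))

theorem HasRefinement.exists_common_summand_of_below (href : HasRefinement V) {y a w : V}
    (h : Below y (a + w)) :
    ∃ x y' a', y = x + y' ∧ a = x + a' ∧ Below y' (w + x) := by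
  obtain ⟨m, r, hr⟩ := h
  obtain ⟨x, y', a', h₁, h₂, h₃⟩ :=
    href.exists_common_summand a (m • w) m y r (by rw [hr, smul_add])
  exact ⟨x, y', a', h₁, h₂, h₃.trans (.add (.right _ _) ((Below.nsmul _ _).trans (.left _ _)))⟩

/-- If `c + d = b + d`, then `c` and `b` become equal after a common summand `x` of `a` and `d` is
added to both, provided `d` lies in the order ideals of `a + b` and of `a + c`. -/
theorem IsSeparative.exists_add_eq_add (hsep : IsSeparative V) (href : HasRefinement V)
    {a b c d : V} (h : c + d = b + d) (hb : Below d (a + b)) (hc : Below d (a + c)) :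
    ∃ x a' d', a = x + a' ∧ d = x + d' ∧ b + x = c + x := by
  obtain ⟨x, d₁, a₁, rfl, rfl, h₁⟩ := href.exists_common_summand_of_below hb
  obtain ⟨y, d₂, a₂, rfl, rfl, h₂⟩ := href.exists_common_summand_of_below
    (y := d₁) (a := a₁) (w := c + x)
    (Below.trans (.right x d₁) (by rwa [show a₁ + (c + x) = x + a₁ + c by abel]))
  refine ⟨x + y, a₂, d₂, by abel, by abel, hsep.cancel (c := d₂) ?_ ?_ ?_⟩
  · calc _ = b + (x + (y + d₂)) := by abel
      _ = c + (x + (y + d₂)) := h.symm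
      _ = _ := by abel
  · exact (Below.right y d₂).trans (h₁.trans (.of_add_eq (t := y) (by abel)))
  · rwa [← add_assoc]

/-- The arithmetic of diagonal reduction: if `k + i = l + i = u + v` with `v` in the order ideal of
`u`, then `k`, `i`, `l` split compatibly with `u` and `v`. -/
theorem IsSeparative.exists_compatible_splitting (hsep : IsSeparative V) (href : HasRefinement V)
    {k i l u v : V} (hk : k + i = u + v) (hl : l + i = u + v) (hv : Below v u) :
    ∃ k₁ k₂ i₁ i₂ l₁ l₂, k = k₁ + k₂ ∧ i = i₁ + i₂ ∧ l = l₁ + l₂ ∧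
      k₁ + i₁ = u ∧ l₁ + i₁ = u ∧ k₂ + i₂ = v ∧ l₂ + i₂ = v := by
  obtain ⟨k₁, k₂, i₁, i₂, rfl, rfl, rfl, rfl⟩ := href _ _ _ _ hk
  -- Moving a common summand of `k₁` and `i₂` makes `i₂` lie in the order ideal of `i₁`.
  obtain ⟨x, i₂', k₁', rfl, rfl, hi⟩ := href.exists_common_summand_of_below
    (y := i₂) (a := k₁) (w := i₁) ((Below.right k₂ i₂).trans hv)
  have h : x + k₁' + k₂ + (i₁ + x) = l + (i₁ + x) := by
    refine hsep.cancel (c := i₂') ?_ (hi.trans (.right _ _)) (hi.trans (.right _ _))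
    calc _ = x + k₁' + k₂ + (i₁ + (x + i₂')) := by abel
      _ = l + (i₁ + (x + i₂')) := by rw [hk, hl]
      _ = _ := by abel
  obtain ⟨l₁, l₂, p, q, rfl, hpq, hu, hq⟩ :=
    href l (i₁ + x) (x + k₁' + i₁) (k₂ + x) (by rw [← h]; abel)
  refine ⟨k₁' + q, l₂, p, i₂' + q, l₁, l₂, ?_, ?_, rfl, ?_, hu.symm, ?_, ?_⟩
  · calc _ = k₁' + (k₂ + x) := by abel
      _ = _ := by rw [hq]; abel
  · calc _ = i₁ + x + i₂' := by abel
      _ = _ := by rw [hpq]; abel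
  · calc _ = k₁' + (p + q) := by abel
      _ = _ := by rw [← hpq]; abel
  · calc _ = l₂ + q + i₂' := by abel
      _ = _ := by rw [← hq]; abel
  · calc _ = l₂ + q + i₂' := by abel
      _ = _ := by rw [← hq]; abel

end Monoid

/-! ### Exchange in terms of invariant sections -/

section Exchange

variable {S : Type u} [Ring S]

/-- The form of the exchange property used here: given an idempotent endomorphism `ε` of `A`, every
split epimorphism `π : A → P` has a section `ι` whose range is invariant under `ε`, that is,
`ε ∘ ι = ι ∘ e` for some endomorphism `e` of `P`. Equivalently, for `A = X ⊕ Y`, the kernel of `π`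
has a complement of the form `X' ⊕ Y'` with `X' ≤ X` and `Y' ≤ Y`. -/
def HasInvariantSections (S : Type u) [Ring S] (P : Type u) [AddCommGroup P] [Module S P] : Prop :=
  ∀ (A : Type u) [AddCommGroup A] [Module S A] (π : A →ₗ[S] P) (s : P →ₗ[S] A) (ε : A →ₗ[S] A),
    (∀ z, π (s z) = z) → (∀ a, ε (ε a) = ε a) →
      ∃ (ι : P →ₗ[S] A) (e : P →ₗ[S] P), (∀ z, π (ι z) = z) ∧ ∀ z, ε (ι z) = ι (e z)

variable {P Q : Type u} [AddCommGroup P] [Module S P] [AddCommGroup Q] [Module S Q]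

/-- The case of `P × P` with its first projection and the map `(a, b) ↦ f a + (1 - f) b`, for all
endomorphisms `f`, implies the general case. -/
theorem HasInvariantSections.of_suitable
    (h : ∀ f : P →ₗ[S] P, ∃ x y e : P →ₗ[S] P, (∀ z, f (x z) + (y z - f (y z)) = z) ∧
      (∀ z, x (e z) = x z) ∧ ∀ z, y (e z) = 0) :
    HasInvariantSections S P := by
  intro A _ _ π s ε hs hε
  obtain ⟨x, y, e, h₁, h₂, h₃⟩ := h (π ∘ₗ ε ∘ₗ s)
  refine ⟨ε ∘ₗ s ∘ₗ x + (s ∘ₗ y - ε ∘ₗ s ∘ₗ y), e, fun z => ?_, fun z => ?_⟩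
  · simpa [hs] using h₁ z
  · simp [hε, h₂, h₃]

/-- The kernel of `(a, b) ↦ f a + (1 - f) b` is a copy of `P` and has the diagonal as a complement.
Exchanging it against the two coordinate axes gives a complement that is invariant under the
coordinate projections, hence an invariant section of this map. -/
theorem HasFiniteExchange.hasInvariantSections (h : HasFiniteExchange S P) :
    HasInvariantSections S P := by
  refine .of_suitable fun f => ?_
  let ρ : P × P →ₗ[S] P := f.coprod (LinearMap.id - f)
  have hρ : ∀ a b, ρ (a, b) = f a + (b - f b) := fun a b => by simp [ρ]
  let δ : P →ₗ[S] P × P := LinearMap.id.prod LinearMap.id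
  have hρδ : ∀ z, ρ (δ z) = z := fun z => by simp [ρ, δ]
  let j : P →ₗ[S] P × P := (LinearMap.id - f).prod (-f)
  have hj : Function.Injective j := by
    have : Function.LeftInverse (fun a : P × P => a.1 - a.2) j := fun z => by simp [j]
    exact this.injective
  have hjρ : LinearMap.range j = LinearMap.ker ρ := by
    ext ⟨a, b⟩
    simp only [LinearMap.mem_range, LinearMap.mem_ker, hρ]
    constructor
    · rintro ⟨z, hz⟩
      obtain ⟨rfl, rfl⟩ := Prod.mk_inj.1 hz
      simp
    · intro hab
      have hb : f (a - b) = -b := by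
        rw [map_sub, eq_neg_iff_add_eq_zero, ← hab]
        abel
      exact ⟨a - b, Prod.ext (by simp [j, hb]) (by simp [j, hb])⟩
  have hcompl : IsCompl (LinearMap.range j) (LinearMap.range δ) := by
    rw [hjρ, isCompl_comm]
    refine ⟨Submodule.disjoint_def.2 ?_, codisjoint_iff_le_sup.2 fun a _ => ?_⟩
    · rintro _ ⟨z, rfl⟩ hz
      rw [LinearMap.mem_ker, hρδ] at hz
      rw [hz, map_zero]
    · refine Submodule.mem_sup.2 ⟨δ (ρ a), ⟨_, rfl⟩, a - δ (ρ a), ?_, by abel⟩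
      rw [LinearMap.mem_ker, map_sub, hρδ, sub_self]
  let B : Fin 2 → Submodule S (P × P) :=
    ![LinearMap.ker (LinearMap.snd S P P), LinearMap.ker (LinearMap.fst S P P)]
  have hB : DirectSum.IsInternal B := by
    rw [DirectSum.isInternal_submodule_iff_isCompl B (i := 0) (j := 1) (by decide)
      (by ext i; fin_cases i <;> simp)]
    refine ⟨Submodule.disjoint_def.2 ?_, codisjoint_iff_le_sup.2 fun a _ => ?_⟩
    · rintro ⟨a, b⟩ h₁ h₂
      simp [B] at h₁ h₂
      simp [h₁, h₂]
    · exact Submodule.mem_sup.2 ⟨(a.1, 0), by simp [B], (0, a.2), by simp [B], by simp⟩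
  obtain ⟨B', hB', hint⟩ := h (P × P) _ _ 2 B ⟨(LinearEquiv.ofInjective j hj).symm⟩ hcompl hB
  rw [DirectSum.isInternal_submodule_iff_iSupIndep_and_iSup_eq_top] at hint
  let N : Submodule S (P × P) := B' 0 ⊔ B' 1
  have hN : IsCompl N (LinearMap.ker ρ) := by
    rw [isCompl_comm, ← hjρ]
    constructor
    · refine (hint.1 0).mono_right (sup_le ?_ ?_)
      · exact le_iSup₂_of_le (1 : Fin 3) (by decide) le_rfl
      · exact le_iSup₂_of_le (2 : Fin 3) (by decide) le_rfl
    · rw [codisjoint_iff_le_sup, ← hint.2]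
      refine iSup_le fun i => ?_
      refine Fin.cases le_sup_left (fun i => le_sup_of_le_right ?_) i
      fin_cases i
      · exact le_sup_left (a := B' 0)
      · exact le_sup_right (a := B' 0)
  let ι : P →ₗ[S] P × P := N.projection _ hN ∘ₗ δ
  have hρι : ∀ z, ρ (ι z) = z := by
    intro z
    have h₀ := Submodule.projection_add_projection_eq_self hN (δ z)
    have h₁ : ρ ((LinearMap.ker ρ).projection _ hN.symm (δ z)) = 0 :=
      Submodule.projection_apply_mem hN.symm _
    have h₂ := congrArg ρ h₀
    rwa [map_add, h₁, add_zero, hρδ] at h₂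
  have hιρ : ∀ n ∈ N, ι (ρ n) = n := by
    intro n hn
    have h₀ : N.projection _ hN (δ (ρ n) - n) = 0 := by
      rw [Submodule.projection_apply_eq_zero_iff, LinearMap.mem_ker, map_sub, hρδ, sub_self]
    rw [map_sub, Submodule.projection_apply_of_mem_left hN hn, sub_eq_zero] at h₀
    exact h₀
  have hfst : ∀ n ∈ N, (n.1, 0) ∈ N := by
    intro n hn
    obtain ⟨a, ha, b, hb, rfl⟩ := Submodule.mem_sup.1 hn
    have h₁ := hB' 0 ha
    have h₂ := hB' 1 hb
    simp only [B, Matrix.cons_val_zero, Matrix.cons_val_one, LinearMap.mem_ker,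
      LinearMap.fst_apply, LinearMap.snd_apply] at h₁ h₂
    have : ((a + b).1, (0 : P)) = a := Prod.ext (by simp [h₂]) (by simp [h₁])
    rw [this]
    exact Submodule.mem_sup_left ha
  have hιN : ∀ z, ι z ∈ N := fun z => Submodule.projection_apply_mem hN _
  have key : ∀ z, ι (ρ ((ι z).1, 0)) = ((ι z).1, 0) := fun z => hιρ _ (hfst _ (hιN z))
  refine ⟨LinearMap.fst S P P ∘ₗ ι, LinearMap.snd S P P ∘ₗ ι,
    ρ ∘ₗ LinearMap.inl S P P ∘ₗ LinearMap.fst S P P ∘ₗ ι, fun z => ?_, fun z => ?_, fun z => ?_⟩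
  · exact (hρ _ _).symm.trans (hρι z)
  · change (ι (ρ ((ι z).1, 0))).1 = (ι z).1
    rw [key]
  · change (ι (ρ ((ι z).1, 0))).2 = 0
    rw [key]

/-- Given an invariant section `ι₁` for the first component, the second component is corrected so
as to vanish on the range of `ι₁` before an invariant section `ι₂` for it is chosen. The pair
`(ι₁, ι₂)` is a section up to an automorphism of `P × Q`. -/
theorem HasInvariantSections.prod (hP : HasInvariantSections S P)
    (hQ : HasInvariantSections S Q) : HasInvariantSections S (P × Q) := by
  intro A _ _ π s ε hs hε
  let π₁ : A →ₗ[S] P := LinearMap.fst S P Q ∘ₗ π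
  let π₂ : A →ₗ[S] Q := LinearMap.snd S P Q ∘ₗ π
  have hπ : ∀ a, π a = (π₁ a, π₂ a) := fun a => rfl
  obtain ⟨ι₁, e₁, h₁, hε₁⟩ := hP A π₁ (s ∘ₗ LinearMap.inl S P Q) ε
    (fun z => by simp [π₁, hs]) hε
  obtain ⟨ι₂, e₂, h₂, hε₂⟩ := hQ A (π₂ - π₂ ∘ₗ ι₁ ∘ₗ π₁) (s ∘ₗ LinearMap.inr S P Q) ε
    (fun z => by simp [π₁, π₂, hs]) hε
  have h₂' : ∀ q, π₂ (ι₂ q) = q + π₂ (ι₁ (π₁ (ι₂ q))) := fun q => by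
    simpa [sub_eq_iff_eq_add] using h₂ q
  -- The inverse of the matrix `(1, x; y, 1 + y x)` with `x = π₁ ι₂` and `y = π₂ ι₁`.
  let τ : P × Q →ₗ[S] Q := LinearMap.snd S P Q - π₂ ∘ₗ ι₁ ∘ₗ LinearMap.fst S P Q
  let σ : P × Q →ₗ[S] P := LinearMap.fst S P Q - π₁ ∘ₗ ι₂ ∘ₗ τ
  let M : P × Q →ₗ[S] P × Q := π ∘ₗ ι₁.coprod ι₂
  have hM : ∀ z : P × Q, (σ (M z), τ (M z)) = z := by
    rintro ⟨p, q⟩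
    have : τ (M (p, q)) = q := by simp [τ, M, hπ, h₁, h₂']
    refine Prod.ext ?_ this
    change σ (M (p, q)) = p
    simp only [σ, LinearMap.sub_apply, LinearMap.comp_apply, this]
    simp [M, hπ, h₁]
  refine ⟨ι₁.coprod ι₂ ∘ₗ σ.prod τ, M ∘ₗ e₁.prodMap e₂ ∘ₗ σ.prod τ, fun z => ?_, fun z => ?_⟩
  · have : τ z = z.2 - π₂ (ι₁ z.1) := rfl
    have : σ z = z.1 - π₁ (ι₂ (τ z)) := rfl
    refine Prod.ext ?_ ?_
    · simp [hπ, h₁, this]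
    · simp [hπ, h₂', this]
      simp [τ]
  · have := hM (e₁ (σ z), e₂ (τ z))
    obtain ⟨hσ, hτ⟩ := Prod.mk_inj.1 this
    change ε (ι₁ (σ z) + ι₂ (τ z)) =
      ι₁ (σ (M (e₁ (σ z), e₂ (τ z)))) + ι₂ (τ (M (e₁ (σ z), e₂ (τ z))))
    rw [hσ, hτ, map_add, hε₁, hε₂]

theorem HasInvariantSections.of_retract (hP : HasInvariantSections S P) (i : Q →ₗ[S] P)
    (j : P →ₗ[S] Q) (hij : ∀ z, j (i z) = z) : HasInvariantSections S Q := by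
  intro A _ _ π s ε hs hε
  -- `A × P` maps onto `P = Q ⊕ ker j`; the idempotent `ε × 0` forces `e` to take values in `Q`.
  obtain ⟨ι, e, hι, he⟩ := hP (A × P)
    ((i ∘ₗ π).coprod (LinearMap.id - i ∘ₗ j)) ((s ∘ₗ j).prod LinearMap.id)
    (ε.prodMap 0) (fun z => by simp [hs]) (fun a => by simp [hε])
  have h₁ : ∀ z, i (π (ι z).1) + ((ι z).2 - i (j (ι z).2)) = z := fun z => by simpa using hι z
  have h₂ : ∀ z, π (ι z).1 = j z := fun z => by simpa [hij] using congrArg j (h₁ z)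
  have h₃ : ∀ z, ε (ι z).1 = (ι (e z)).1 := fun z => by simpa using congrArg Prod.fst (he z)
  have h₄ : ∀ z, (ι (e z)).2 = 0 := fun z => by simpa using (congrArg Prod.snd (he z)).symm
  have h₅ : ∀ z, i (j (e z)) = e z := fun z => by simpa [h₄, h₂] using h₁ (e z)
  refine ⟨LinearMap.fst S A P ∘ₗ ι ∘ₗ i, j ∘ₗ e ∘ₗ i, fun z => ?_, fun z => ?_⟩
  · simp [h₂, hij]
  · simp [h₃, h₅]

theorem HasInvariantSections.of_equiv (hP : HasInvariantSections S P) (e : P ≃ₗ[S] Q) :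
    HasInvariantSections S Q :=
  hP.of_retract e.symm.toLinearMap e.toLinearMap fun z => by simp

theorem HasInvariantSections.pi_fin (hP : HasInvariantSections S P) (n : ℕ) :
    HasInvariantSections S (Fin n → P) := by
  induction n with
  | zero => exact hP.of_retract 0 0 fun z => Subsingleton.elim _ _
  | succ n ih => exact (hP.prod ih).of_equiv (Fin.consLinearEquiv S fun _ => P)

theorem HasInvariantSections.of_finite_projective (hS : HasInvariantSections S S)
    [Module.Finite S P] [Module.Projective S P] : HasInvariantSections S P := by
  obtain ⟨n, f, hf⟩ := Module.Finite.exists_fin' S P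
  obtain ⟨g, hg⟩ := Module.projective_lifting_property f LinearMap.id hf
  exact (hS.pi_fin n).of_retract g f fun z => LinearMap.congr_fun hg z

/-- A product decomposition can be refined so as to contain a complement of the kernel of a split
epimorphism onto a module with the exchange property. -/
theorem HasInvariantSections.exists_isCompl_ker (hP : HasInvariantSections S P)
    {X Y : Type u} [AddCommGroup X] [Module S X] [AddCommGroup Y] [Module S Y]
    (π : X × Y →ₗ[S] P) (s : P →ₗ[S] X × Y) (hs : ∀ z, π (s z) = z) :
    ∃ (X₁ X₂ : Submodule S X) (Y₁ Y₂ : Submodule S Y), IsCompl X₁ X₂ ∧ IsCompl Y₁ Y₂ ∧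
      IsCompl (X₁.prod Y₁) (LinearMap.ker π) := by
  obtain ⟨ι, e, hι, he⟩ := hP (X × Y) π s (LinearMap.inl S X Y ∘ₗ LinearMap.fst S X Y) hs (by simp)
  let π₁ : X →ₗ[S] P := π ∘ₗ LinearMap.inl S X Y
  let π₂ : Y →ₗ[S] P := π ∘ₗ LinearMap.inr S X Y
  let ι₁ : P →ₗ[S] X := LinearMap.fst S X Y ∘ₗ ι
  let ι₂ : P →ₗ[S] Y := LinearMap.snd S X Y ∘ₗ ι
  have hπ : ∀ x y, π (x, y) = π₁ x + π₂ y := fun x y => by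
    simp [π₁, π₂, ← map_add]
  have hιz : ∀ z, ι z = (ι₁ z, ι₂ z) := fun z => rfl
  have h₁ : ∀ z, ι₁ (e z) = ι₁ z := fun z => (congrArg Prod.fst (he z)).symm
  have h₂ : ∀ z, ι₂ (e z) = 0 := fun z => (congrArg Prod.snd (he z)).symm
  have h₃ : ∀ z, π₁ (ι₁ z) + π₂ (ι₂ z) = z := fun z => by rw [← hπ, ← hιz, hι]
  have h₄ : ∀ z, π₁ (ι₁ z) = e z := fun z => by simpa [h₁, h₂] using h₃ (e z)
  have h₅ : ∀ z, π₂ (ι₂ z) = z - e z := fun z => by rw [← h₄, eq_sub_iff_add_eq', h₃]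
  have id₁ : IsIdempotentElem (ι₁ ∘ₗ π₁) := by
    ext x; simp [h₄, h₁]
  have id₂ : IsIdempotentElem (ι₂ ∘ₗ π₂) := by
    ext y; simp [h₅, h₂]
  refine ⟨_, _, _, _, LinearMap.IsIdempotentElem.isCompl id₁,
    LinearMap.IsIdempotentElem.isCompl id₂, ?_⟩
  have hr : (LinearMap.range (ι₁ ∘ₗ π₁)).prod (LinearMap.range (ι₂ ∘ₗ π₂)) = LinearMap.range ι := by
    ext ⟨x, y⟩
    constructor
    · rintro ⟨⟨x, rfl⟩, ⟨y, rfl⟩⟩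
      exact ⟨e (π₁ x) + (π₂ y - e (π₂ y)), by simp [hιz, h₁, h₂]⟩
    · rintro ⟨z, hz⟩
      rw [hιz] at hz
      obtain ⟨rfl, rfl⟩ := Prod.mk_inj.1 hz
      exact ⟨⟨ι₁ z, by simp [h₄, h₁]⟩, ⟨ι₂ z, by simp [h₅, h₂]⟩⟩
  rw [hr]
  refine ⟨Submodule.disjoint_def.2 ?_, codisjoint_iff_le_sup.2 fun a _ => ?_⟩
  · rintro _ ⟨z, rfl⟩ hz
    rw [LinearMap.mem_ker, hι] at hz
    rw [hz, map_zero]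
  · refine Submodule.mem_sup.2 ⟨ι (π a), ⟨_, rfl⟩, a - ι (π a), ?_, by abel⟩
    rw [LinearMap.mem_ker, map_sub, hι, sub_self]

end Exchange

/-! ### The monoid of isomorphism classes of finitely generated projective modules -/

/-- A finitely generated projective `S`-module, bundled. -/
structure FinProj (S : Type u) [Ring S] where
  carrier : Type u
  [addCommGroup : AddCommGroup carrier]
  [module : Module S carrier]
  [finite : Module.Finite S carrier]
  [projective : Module.Projective S carrier]

attribute [instance] FinProj.addCommGroup FinProj.module FinProj.finite FinProj.projective

instance FinProj.setoid (S : Type u) [Ring S] : Setoid (FinProj S) where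
  r P Q := Nonempty (P.carrier ≃ₗ[S] Q.carrier)
  iseqv := ⟨fun _ => ⟨.refl _ _⟩, fun ⟨e⟩ => ⟨e.symm⟩, fun ⟨e⟩ ⟨f⟩ => ⟨e.trans f⟩⟩

/-- The monoid `V(S)`: isomorphism classes of finitely generated projective `S`-modules, with
addition induced by direct sums. -/
def ProjClass (S : Type u) [Ring S] : Type (u + 1) :=
  Quotient (FinProj.setoid S)

section ProjClass

variable {S : Type u} [Ring S]

/-- The class in `V(S)` of a finitely generated projective `S`-module. -/
def projClass (S : Type u) [Ring S] (P : Type u) [AddCommGroup P] [Module S P] [Module.Finite S P]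
    [Module.Projective S P] : ProjClass S :=
  Quotient.mk _ ⟨P⟩

theorem ProjClass.ind {p : ProjClass S → Prop}
    (h : ∀ (P : Type u) [AddCommGroup P] [Module S P] [Module.Finite S P] [Module.Projective S P],
      p (projClass S P)) (a : ProjClass S) : p a :=
  Quotient.ind (fun P => h P.carrier) a

instance : Add (ProjClass S) where
  add := Quotient.map₂ (fun P Q => ⟨P.carrier × Q.carrier⟩)
    fun _ _ ⟨e⟩ _ _ ⟨f⟩ => ⟨e.prodCongr f⟩

instance : Zero (ProjClass S) where
  zero := projClass S PUnit

instance : AddCommMonoid (ProjClass S) where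
  add_assoc a b c := by
    induction a, b, c using Quotient.inductionOn₃ with
    | h P Q T => exact Quotient.sound ⟨LinearEquiv.prodAssoc S _ _ _⟩
  add_comm a b := by
    induction a, b using Quotient.inductionOn₂ with
    | h P Q => exact Quotient.sound ⟨LinearEquiv.prodComm S _ _⟩
  zero_add a := by
    induction a using Quotient.inductionOn with
    | h P => exact Quotient.sound ⟨LinearEquiv.uniqueProd⟩
  add_zero a := by
    induction a using Quotient.inductionOn with
    | h P => exact Quotient.sound ⟨LinearEquiv.prodUnique⟩
  nsmul := nsmulRec

section

variable {P Q T : Type u} [AddCommGroup P] [Module S P] [Module.Finite S P] [Module.Projective S P]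
  [AddCommGroup Q] [Module S Q] [Module.Finite S Q] [Module.Projective S Q]
  [AddCommGroup T] [Module S T] [Module.Finite S T] [Module.Projective S T]

theorem projClass_prod : projClass S (P × Q) = projClass S P + projClass S Q := rfl

theorem projClass_eq_iff : projClass S P = projClass S Q ↔ Nonempty (P ≃ₗ[S] Q) :=
  Quotient.eq (r := FinProj.setoid S)

theorem projClass_eq (e : P ≃ₗ[S] Q) : projClass S P = projClass S Q :=
  projClass_eq_iff.2 ⟨e⟩

theorem projClass_eq_add_iff :
    projClass S P = projClass S Q + projClass S T ↔ Nonempty (P ≃ₗ[S] Q × T) := by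
  rw [← projClass_prod, projClass_eq_iff]

instance Module.Projective.pi_fin (n : ℕ) : Module.Projective S (Fin n → P) := by
  induction n with
  | zero => exact .of_split (0 : (Fin 0 → P) →ₗ[S] P) 0 (Subsingleton.elim _ _)
  | succ n ih => exact .of_equiv (Fin.consLinearEquiv S fun _ => P)

theorem projClass_pi_fin (n : ℕ) : projClass S (Fin n → P) = n • projClass S P := by
  induction n with
  | zero =>
    rw [zero_smul]
    exact projClass_eq (Q := PUnit) ⟨0, fun _ _ => 0, fun _ => Subsingleton.elim _ _, fun _ => rfl⟩
  | succ n ih =>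
    rw [succ_nsmul', ← ih, projClass_eq_add_iff]
    exact ⟨(Fin.consLinearEquiv S fun _ => P).symm⟩

end

section

variable {P : Type u} [AddCommGroup P] [Module S P]

theorem Submodule.projective_of_isCompl [Module.Projective S P] {X Y : Submodule S P}
    (h : IsCompl X Y) : Module.Projective S X :=
  .of_split X.subtype (X.projectionOnto Y h) (Submodule.projectionOnto_comp_subtype h)

theorem Submodule.finite_of_isCompl [Module.Finite S P] {X Y : Submodule S P} (h : IsCompl X Y) :
    Module.Finite S X :=
  .of_surjective (X.projectionOnto Y h) (Submodule.projectionOnto_surjective h)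

end

theorem isSeparative_projClass
    (hsep : ∀ (P Q : Type u) [AddCommGroup P] [AddCommGroup Q] [Module S P] [Module S Q]
      [Module.Finite S P] [Module.Finite S Q] [Module.Projective S P] [Module.Projective S Q],
      Nonempty ((P × P) ≃ₗ[S] (P × Q)) → Nonempty ((P × Q) ≃ₗ[S] (Q × Q)) →
        Nonempty (P ≃ₗ[S] Q)) :
    IsSeparative (ProjClass S) := by
  intro a b h₁ h₂
  induction a using ProjClass.ind with | h P => ?_
  induction b using ProjClass.ind with | h Q => ?_
  rw [← projClass_prod, ← projClass_prod, projClass_eq_iff] at h₁ h₂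
  exact projClass_eq_iff.2 (hsep P Q h₁ h₂)

section

variable {X Y : Type u} [AddCommGroup X] [Module S X] [AddCommGroup Y] [Module S Y]

theorem Submodule.isCompl_prod {X₁ X₂ : Submodule S X} {Y₁ Y₂ : Submodule S Y}
    (hX : IsCompl X₁ X₂) (hY : IsCompl Y₁ Y₂) : IsCompl (X₁.prod Y₁) (X₂.prod Y₂) := by
  constructor
  · rw [disjoint_iff, Submodule.prod_inf_prod, hX.inf_eq_bot, hY.inf_eq_bot, Submodule.prod_bot]
  · rw [codisjoint_iff, Submodule.prod_sup_prod, hX.sup_eq_top, hY.sup_eq_top, Submodule.prod_top]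

/-- The product of two submodules, as a submodule of the product, is the product of the modules. -/
def Submodule.prodEquivProd (X₁ : Submodule S X) (Y₁ : Submodule S Y) :
    X₁.prod Y₁ ≃ₗ[S] X₁ × Y₁ where
  toFun a := (⟨a.1.1, a.2.1⟩, ⟨a.1.2, a.2.2⟩)
  invFun a := ⟨(a.1, a.2), a.1.2, a.2.2⟩
  map_add' _ _ := rfl
  map_smul' _ _ := rfl
  left_inv _ := rfl
  right_inv _ := rfl

/-- Two complements of the same submodule are isomorphic. -/
noncomputable def Submodule.equivOfIsCompl {X₁ X₂ Z : Submodule S X} (h₁ : IsCompl Z X₁)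
    (h₂ : IsCompl Z X₂) : X₁ ≃ₗ[S] X₂ :=
  (Z.quotientEquivOfIsCompl X₁ h₁).symm.trans (Z.quotientEquivOfIsCompl X₂ h₂)

/-- A complement of the kernel of a surjection is isomorphic to the codomain. -/
noncomputable def Submodule.equivOfIsComplKer {X₁ : Submodule S X} {π : X →ₗ[S] Y}
    (h : IsCompl X₁ (LinearMap.ker π)) (hπ : Function.Surjective π) : X₁ ≃ₗ[S] Y :=
  ((LinearMap.ker π).quotientEquivOfIsCompl X₁ h.symm).symm.trans (π.quotKerEquivOfSurjective hπ)

/-- The kernel of the first projection from a module isomorphic to `X × Y` is isomorphic to `Y`. -/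
def LinearEquiv.kerFst {A : Type u} [AddCommGroup A] [Module S A] (φ : A ≃ₗ[S] X × Y) :
    LinearMap.ker (LinearMap.fst S X Y ∘ₗ φ.toLinearMap) ≃ₗ[S] Y where
  toFun a := (φ a).2
  invFun y := ⟨φ.symm (0, y), by simp⟩
  map_add' a b := by simp
  map_smul' r a := by simp
  left_inv a := by
    have h : (φ a).1 = 0 := a.2
    exact Subtype.ext (φ.symm_apply_eq.2 (Prod.ext h.symm rfl))
  right_inv y := by simp

end

theorem hasRefinement_projClass (hS : HasInvariantSections S S) :
    HasRefinement (ProjClass S) := by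
  intro a b c d h
  induction a using ProjClass.ind with | h P => ?_
  induction b using ProjClass.ind with | h Q => ?_
  induction c using ProjClass.ind with | h X => ?_
  induction d using ProjClass.ind with | h Y => ?_
  rw [← projClass_prod, ← projClass_prod, projClass_eq_iff] at h
  obtain ⟨φ⟩ := h
  let π : X × Y →ₗ[S] P := LinearMap.fst S P Q ∘ₗ φ.symm.toLinearMap
  have hs : ∀ z, π ((φ.toLinearMap ∘ₗ LinearMap.inl S P Q) z) = z := fun z => by simp [π]
  obtain ⟨X₁, X₂, Y₁, Y₂, hX, hY, h⟩ :=
    (HasInvariantSections.of_finite_projective hS (P := P)).exists_isCompl_ker π _ hs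
  have hπ : Function.Surjective π := fun z => ⟨_, hs z⟩
  have := Submodule.projective_of_isCompl hX
  have := Submodule.projective_of_isCompl hX.symm
  have := Submodule.projective_of_isCompl hY
  have := Submodule.projective_of_isCompl hY.symm
  have := Submodule.finite_of_isCompl hX
  have := Submodule.finite_of_isCompl hX.symm
  have := Submodule.finite_of_isCompl hY
  have := Submodule.finite_of_isCompl hY.symm
  refine ⟨projClass S X₁, projClass S Y₁, projClass S X₂, projClass S Y₂, ?_, ?_, ?_, ?_⟩
  · exact projClass_eq_add_iff.2
      ⟨(Submodule.equivOfIsComplKer h hπ).symm.trans (Submodule.prodEquivProd X₁ Y₁)⟩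
  · exact projClass_eq_add_iff.2 ⟨(LinearEquiv.kerFst φ.symm).symm.trans <|
      (Submodule.equivOfIsCompl h (Submodule.isCompl_prod hX hY)).trans <|
      Submodule.prodEquivProd X₂ Y₂⟩
  · exact projClass_eq_add_iff.2 ⟨(Submodule.prodEquivOfIsCompl X₁ X₂ hX).symm⟩
  · exact projClass_eq_add_iff.2 ⟨(Submodule.prodEquivOfIsCompl Y₁ Y₂ hY).symm⟩

end ProjClass

/-! ### Automorphisms of a product of two modules -/

section Elementary

variable {S : Type u} [Ring S] {Q P : Type u} [AddCommGroup Q] [Module S Q] [AddCommGroup P]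
  [Module S P]

/-- The automorphism `(q, p) ↦ (q + φ p, p)` of `Q × P`. -/
def LinearMap.shearFst (φ : P →ₗ[S] Q) : (Q × P) ≃ₗ[S] (Q × P) where
  toFun a := (a.1 + φ a.2, a.2)
  invFun a := (a.1 - φ a.2, a.2)
  map_add' a b := by ext <;> simp; abel
  map_smul' r a := by ext <;> simp
  left_inv a := by simp
  right_inv a := by simp

/-- The automorphism `(q, p) ↦ (q, p + ψ q)` of `Q × P`. -/
def LinearMap.shearSnd (ψ : Q →ₗ[S] P) : (Q × P) ≃ₗ[S] (Q × P) where
  toFun a := (a.1, a.2 + ψ a.1)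
  invFun a := (a.1, a.2 - ψ a.1)
  map_add' a b := by ext <;> simp; abel
  map_smul' r a := by ext <;> simp
  left_inv a := by simp
  right_inv a := by simp

@[simp]
theorem LinearMap.shearFst_apply (φ : P →ₗ[S] Q) (a : Q × P) :
    φ.shearFst a = (a.1 + φ a.2, a.2) := rfl

@[simp]
theorem LinearMap.shearSnd_apply (ψ : Q →ₗ[S] P) (a : Q × P) :
    ψ.shearSnd a = (a.1, a.2 + ψ a.1) := rfl

variable (S Q P) in
/-- The group of automorphisms of `Q × P` generated by the two kinds of shears. -/
def shearGroup : Subgroup ((Q × P) ≃ₗ[S] (Q × P)) :=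
  Subgroup.closure (Set.range LinearMap.shearFst ∪ Set.range LinearMap.shearSnd)

theorem shearFst_mem (φ : P →ₗ[S] Q) : φ.shearFst ∈ shearGroup S Q P :=
  Subgroup.subset_closure (.inl ⟨φ, rfl⟩)

theorem shearSnd_mem (ψ : Q →ₗ[S] P) : ψ.shearSnd ∈ shearGroup S Q P :=
  Subgroup.subset_closure (.inr ⟨ψ, rfl⟩)

/-- The pair `(X, Y)` of submodules is the image of the coordinate pair `(Q × 0, 0 × P)` under an
element of the group generated by the shears. -/
def ShearReachable (X Y : Submodule S (Q × P)) : Prop :=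
  ∃ g ∈ shearGroup S Q P, ∀ a, (g a ∈ X ↔ a.2 = 0) ∧ (g a ∈ Y ↔ a.1 = 0)

/-- A complement of `0 × P` in `Q × P` is the graph of a map `Q → P`, so that a shear moves `Q × 0`
to it. -/
theorem ShearReachable.replace_left {X Y X' : Submodule S (Q × P)} (h : ShearReachable X Y)
    (hX' : IsCompl X' Y) : ShearReachable X' Y := by
  obtain ⟨g, hg, hgXY⟩ := h
  let ψ : Q →ₗ[S] P := LinearMap.snd S Q P ∘ₗ g.symm.toLinearMap ∘ₗ X'.projection Y hX' ∘ₗ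
    g.toLinearMap ∘ₗ LinearMap.inl S Q P
  have key : ∀ q, g (q, ψ q) ∈ X' := by
    intro q
    have h₁ : X'.projection Y hX' (g (q, 0)) - g (q, 0) ∈ Y := by
      rw [← Submodule.projection_apply_eq_zero_iff hX', map_sub,
        Submodule.projection_apply_of_mem_left hX' (Submodule.projection_apply_mem hX' _), sub_self]
    have h₂ : (g.symm (X'.projection Y hX' (g (q, 0))) - (q, 0)).1 = 0 := by
      rw [← (hgXY _).2, map_sub, LinearEquiv.apply_symm_apply]
      exact h₁
    have h₃ : (q, ψ q) = g.symm (X'.projection Y hX' (g (q, 0))) :=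
      Prod.ext (sub_eq_zero.1 h₂).symm rfl
    rw [h₃, LinearEquiv.apply_symm_apply]
    exact Submodule.projection_apply_mem hX' _
  refine ⟨g * ψ.shearSnd, mul_mem hg (shearSnd_mem ψ), fun a => ⟨?_, by simp [hgXY]⟩⟩
  have e : (g * ψ.shearSnd) a = g (a.1, ψ a.1) + g (0, a.2) := by
    rw [LinearEquiv.mul_apply, ← map_add]
    simp [add_comm]
  rw [e, Submodule.add_mem_iff_right _ (key _)]
  constructor
  · intro ha
    have h₀ : g (0, a.2) = 0 := Submodule.disjoint_def.1 hX'.disjoint _ ha ((hgXY _).2.2 rfl)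
    simpa using h₀
  · intro ha
    rw [ha, Prod.mk_zero_zero, map_zero]
    exact zero_mem _

theorem ShearReachable.replace_right {X Y Y' : Submodule S (Q × P)} (h : ShearReachable X Y)
    (hY' : IsCompl X Y') : ShearReachable X Y' := by
  obtain ⟨g, hg, hgXY⟩ := h
  let φ : P →ₗ[S] Q := LinearMap.fst S Q P ∘ₗ g.symm.toLinearMap ∘ₗ Y'.projection X hY'.symm ∘ₗ
    g.toLinearMap ∘ₗ LinearMap.inr S Q P
  have key : ∀ p, g (φ p, p) ∈ Y' := by
    intro p
    have h₁ : Y'.projection X hY'.symm (g (0, p)) - g (0, p) ∈ X := by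
      rw [← Submodule.projection_apply_eq_zero_iff hY'.symm, map_sub,
        Submodule.projection_apply_of_mem_left hY'.symm (Submodule.projection_apply_mem hY'.symm _),
        sub_self]
    have h₂ : (g.symm (Y'.projection X hY'.symm (g (0, p))) - (0, p)).2 = 0 := by
      rw [← (hgXY _).1, map_sub, LinearEquiv.apply_symm_apply]
      exact h₁
    have h₃ : (φ p, p) = g.symm (Y'.projection X hY'.symm (g (0, p))) :=
      Prod.ext rfl (sub_eq_zero.1 h₂).symm
    rw [h₃, LinearEquiv.apply_symm_apply]
    exact Submodule.projection_apply_mem hY'.symm _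
  refine ⟨g * φ.shearFst, mul_mem hg (shearFst_mem φ), fun a => ⟨by simp [hgXY], ?_⟩⟩
  have e : (g * φ.shearFst) a = g (φ a.2, a.2) + g (a.1, 0) := by
    rw [LinearEquiv.mul_apply, ← map_add]
    simp [add_comm]
  rw [e, Submodule.add_mem_iff_right _ (key _)]
  constructor
  · intro ha
    have h₀ : g (a.1, 0) = 0 := Submodule.disjoint_def.1 hY'.disjoint _ ((hgXY _).1.2 rfl) ha
    simpa using h₀
  · intro ha
    rw [ha, Prod.mk_zero_zero, map_zero]
    exact zero_mem _

theorem ShearReachable.coordinates :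
    ShearReachable (LinearMap.ker (LinearMap.snd S Q P)) (LinearMap.ker (LinearMap.fst S Q P)) :=
  ⟨1, one_mem _, fun a => ⟨by simp, by simp⟩⟩

theorem Submodule.isCompl_of_forall_sub_mem {M : Type u} [AddCommGroup M] [Module S M]
    {X Y : Submodule S M} (h₁ : ∀ a ∈ X, a ∈ Y → a = 0) (h₂ : ∀ a, ∃ x ∈ X, a - x ∈ Y) :
    IsCompl X Y := by
  refine ⟨Submodule.disjoint_def.2 h₁, codisjoint_iff_le_sup.2 fun a _ => ?_⟩
  obtain ⟨x, hx, hy⟩ := h₂ a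
  exact Submodule.mem_sup.2 ⟨x, hx, _, hy, by abel⟩

/-- Isomorphic summands `G` of `X` and `H` of `Y` can be interchanged: in a decomposition
`(G ⊕ K) ⊕ (H ⊕ L)`, the graph of an isomorphism `G ≃ H` is a common complement of `G` and `H` in
`G ⊕ H`. -/
theorem ShearReachable.swap {G H K L : Type u} [AddCommGroup G] [Module S G] [AddCommGroup H]
    [Module S H] [AddCommGroup K] [Module S K] [AddCommGroup L] [Module S L]
    (e : (Q × P) ≃ₗ[S] (G × K) × (H × L)) (θ : G ≃ₗ[S] H) {X Y X' Y' : Submodule S (Q × P)}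
    (h : ShearReachable X Y) (hX : ∀ a, a ∈ X ↔ (e a).2 = 0)
    (hX' : ∀ a, a ∈ X' ↔ (e a).1.1 = 0 ∧ (e a).2.2 = 0)
    (hY' : ∀ a, a ∈ Y' ↔ (e a).2.1 = 0 ∧ (e a).1.2 = 0) : ShearReachable X' Y' := by
  let D : ((G × K) × (H × L)) →ₗ[S] K × H :=
    (LinearMap.snd S G K ∘ₗ LinearMap.fst S _ _).prod
      (LinearMap.fst S H L ∘ₗ LinearMap.snd S _ _ -
        θ.toLinearMap ∘ₗ LinearMap.fst S G K ∘ₗ LinearMap.fst S _ _)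
  let Γ : Submodule S (Q × P) := LinearMap.ker (D ∘ₗ e.toLinearMap)
  have hΓ : ∀ a, a ∈ Γ ↔ (e a).1.2 = 0 ∧ (e a).2.1 = θ (e a).1.1 := fun a => by
    simp [Γ, D, sub_eq_zero]
  have h₁ : IsCompl X Γ := by
    refine Submodule.isCompl_of_forall_sub_mem (fun a ha hb => ?_) fun a =>
      ⟨e.symm (((e a).1.1 - θ.symm (e a).2.1, (e a).1.2), 0), ?_, ?_⟩
    · rw [hX] at ha
      rw [hΓ, ha] at hb
      have h₀ : (e a).1.1 = 0 := by simpa using hb.2.symm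
      exact e.map_eq_zero_iff.1 (Prod.ext (Prod.ext h₀ hb.1) ha)
    · simp [hX]
    · simp [hΓ]
  have h₂ : IsCompl X' Γ := by
    refine Submodule.isCompl_of_forall_sub_mem (fun a ha hb => ?_) fun a =>
      ⟨e.symm ((0, (e a).1.2), ((e a).2.1 - θ (e a).1.1, 0)), ?_, ?_⟩
    · rw [hX'] at ha
      rw [hΓ, ha.1, map_zero] at hb
      exact e.map_eq_zero_iff.1 (Prod.ext (Prod.ext ha.1 hb.1) (Prod.ext hb.2 ha.2))
    · simp [hX']
    · simp [hΓ]
  have h₃ : IsCompl X' Y' := by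
    refine Submodule.isCompl_of_forall_sub_mem (fun a ha hb => ?_) fun a =>
      ⟨e.symm ((0, (e a).1.2), ((e a).2.1, 0)), ?_, ?_⟩
    · rw [hX'] at ha
      rw [hY'] at hb
      exact e.map_eq_zero_iff.1 (Prod.ext (Prod.ext ha.1 hb.2) (Prod.ext hb.1 ha.2))
    · simp [hX']
    · simp [hY']
  exact ((h.replace_right h₁).replace_left h₂).replace_right h₃

/-- In a decomposition `(T ⊕ D ⊕ C) ⊕ (B ⊕ T ⊕ A)`, interchange the two copies of `T` and then
`C ⊕ T` with `B ⊕ T`. -/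
theorem ShearReachable.double_swap {T A B C D : Type u} [AddCommGroup T] [Module S T]
    [AddCommGroup A] [Module S A] [AddCommGroup B] [Module S B] [AddCommGroup C] [Module S C]
    [AddCommGroup D] [Module S D] (e : (Q × P) ≃ₗ[S] ((T × D) × C) × (B × (T × A)))
    (β : (B × T) ≃ₗ[S] (C × T)) {X Y X' Y' : Submodule S (Q × P)} (h : ShearReachable X Y)
    (hX : ∀ a, a ∈ X ↔ (e a).2 = 0)
    (hX' : ∀ a, a ∈ X' ↔ (e a).1.2 = 0 ∧ (e a).2.2 = 0)
    (hY' : ∀ a, a ∈ Y' ↔ (e a).1.1 = 0 ∧ (e a).2.1 = 0) : ShearReachable X' Y' := by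
  let r₁ : (((T × D) × C) × (B × (T × A))) ≃ₗ[S] (T × (D × C)) × (T × (B × A)) :=
    { toFun a := ((a.1.1.1, (a.1.1.2, a.1.2)), (a.2.2.1, (a.2.1, a.2.2.2)))
      invFun a := (((a.1.1, a.1.2.1), a.1.2.2), (a.2.2.1, (a.2.1, a.2.2.2)))
      map_add' _ _ := rfl
      map_smul' _ _ := rfl
      left_inv _ := rfl
      right_inv _ := rfl }
  let r₂ : (((T × D) × C) × (B × (T × A))) ≃ₗ[S] ((C × T) × D) × ((B × T) × A) :=
    { toFun a := (((a.1.2, a.2.2.1), a.1.1.2), ((a.2.1, a.1.1.1), a.2.2.2))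
      invFun a := (((a.2.1.2, a.1.2), a.1.1.1), (a.2.1.1, (a.1.1.2, a.2.2)))
      map_add' _ _ := rfl
      map_smul' _ _ := rfl
      left_inv _ := rfl
      right_inv _ := rfl }
  have hr₁ : ∀ a, (e.trans r₁) a =
      (((e a).1.1.1, ((e a).1.1.2, (e a).1.2)), ((e a).2.2.1, ((e a).2.1, (e a).2.2.2))) :=
    fun _ => rfl
  have hr₂ : ∀ a, (e.trans r₂) a = ((((e a).1.2, (e a).2.2.1), (e a).1.1.2),
      (((e a).2.1, (e a).1.1.1), (e a).2.2.2)) := fun _ => rfl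
  let U : Submodule S (Q × P) := LinearMap.ker
    (((LinearMap.fst S T (D × C)).prodMap (LinearMap.snd S T (B × A))) ∘ₗ
      (e.trans r₁).toLinearMap)
  let V : Submodule S (Q × P) := LinearMap.ker
    (((LinearMap.snd S T (D × C)).prodMap (LinearMap.fst S T (B × A))) ∘ₗ
      (e.trans r₁).toLinearMap)
  have hU : ∀ a, a ∈ U ↔ (e a).1.1.1 = 0 ∧ (e a).2.1 = 0 ∧ (e a).2.2.2 = 0 := fun a => by
    simp only [U, LinearMap.mem_ker, LinearMap.comp_apply, LinearEquiv.coe_coe, hr₁,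
      LinearMap.prodMap_apply, LinearMap.fst_apply, LinearMap.snd_apply, Prod.mk_eq_zero]
  have hV : ∀ a, a ∈ V ↔ ((e a).1.1.2 = 0 ∧ (e a).1.2 = 0) ∧ (e a).2.2.1 = 0 := fun a => by
    simp only [V, LinearMap.mem_ker, LinearMap.comp_apply, LinearEquiv.coe_coe, hr₁,
      LinearMap.prodMap_apply, LinearMap.fst_apply, LinearMap.snd_apply, Prod.mk_eq_zero]
  have h₁ : ShearReachable U V := by
    refine h.swap (e.trans r₁) (.refl S T) (fun a => ?_) (fun a => ?_) fun a => ?_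
    · rw [hX, hr₁]
      simp only [Prod.ext_iff, Prod.fst_zero, Prod.snd_zero]
      tauto
    · rw [hU, hr₁]
      simp only [Prod.mk_eq_zero]
    · rw [hV, hr₁]
      simp only [Prod.mk_eq_zero]
      tauto
  refine h₁.swap (e.trans r₂) β.symm (fun a => ?_) (fun a => ?_) fun a => ?_
  · rw [hU, hr₂]
    simp only [Prod.mk_eq_zero]
    tauto
  · rw [hX', hr₂]
    simp only [Prod.ext_iff, Prod.fst_zero, Prod.snd_zero]
    tauto
  · rw [hY', hr₂]
    simp only [Prod.ext_iff, Prod.fst_zero, Prod.snd_zero]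
    tauto

/-- Up to a product of shears, every automorphism `θ` of `Q × P` is diagonal, provided `Q` lies in
the order ideal of `P`. -/
theorem exists_shear_diagonalizing [Module.Finite S Q] [Module.Projective S Q] [Module.Finite S P]
    [Module.Projective S P] (hS : HasInvariantSections S S) (hsep : IsSeparative (ProjClass S))
    (hQP : Below (projClass S Q) (projClass S P)) (θ : (Q × P) ≃ₗ[S] (Q × P)) :
    ∃ g ∈ shearGroup S Q P, ∀ a,
      ((θ (g a)).2 = 0 ↔ a.2 = 0) ∧ ((θ (g a)).1 = 0 ↔ a.1 = 0) := by
  let π : Q × P →ₗ[S] Q := LinearMap.fst S Q P ∘ₗ θ.toLinearMap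
  have hs : ∀ z, π ((θ.symm.toLinearMap ∘ₗ LinearMap.inl S Q P) z) = z := fun z => by simp [π]
  have hπ : Function.Surjective π := fun z => ⟨_, hs z⟩
  obtain ⟨X₁, X₂, Y₁, Y₂, hX, hY, hcompl⟩ :=
    (HasInvariantSections.of_finite_projective hS (P := Q)).exists_isCompl_ker π _ hs
  have := Submodule.projective_of_isCompl hX
  have := Submodule.projective_of_isCompl hX.symm
  have := Submodule.projective_of_isCompl hY
  have := Submodule.projective_of_isCompl hY.symm
  have := Submodule.finite_of_isCompl hX
  have := Submodule.finite_of_isCompl hX.symm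
  have := Submodule.finite_of_isCompl hY
  have := Submodule.finite_of_isCompl hY.symm
  have hQ : projClass S X₂ + projClass S X₁ = projClass S Q :=
    projClass_eq ((LinearEquiv.prodComm S _ _).trans (Submodule.prodEquivOfIsCompl X₁ X₂ hX))
  have hQ' : projClass S Y₁ + projClass S X₁ = projClass S Q :=
    projClass_eq <| (LinearEquiv.prodComm S _ _).trans <|
      (Submodule.prodEquivProd X₁ Y₁).symm.trans (Submodule.equivOfIsComplKer hcompl hπ)
  have hP : projClass S Y₂ + projClass S Y₁ = projClass S P :=
    projClass_eq ((LinearEquiv.prodComm S _ _).trans (Submodule.prodEquivOfIsCompl Y₁ Y₂ hY))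
  have hP' : projClass S Y₂ + projClass S X₂ = projClass S P :=
    projClass_eq <| (LinearEquiv.prodComm S _ _).trans <|
      (Submodule.prodEquivProd X₂ Y₂).symm.trans <|
      (Submodule.equivOfIsCompl (Submodule.isCompl_prod hX hY) hcompl).trans θ.kerFst
  have hB : Below (projClass S X₁) (projClass S P) := .trans (hQ ▸ Below.right _ _) hQP
  obtain ⟨T, Y₂', X₁', hT₁, hT₂, hT⟩ := hsep.exists_add_eq_add (hasRefinement_projClass hS)
    (hQ.trans hQ'.symm) (hP.symm ▸ hB) (hP'.symm ▸ hB)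
  induction T using ProjClass.ind with | h T => ?_
  induction Y₂' using ProjClass.ind with | h Y₂' => ?_
  induction X₁' using ProjClass.ind with | h X₁' => ?_
  obtain ⟨α⟩ := projClass_eq_add_iff.1 hT₁
  obtain ⟨δ⟩ := projClass_eq_add_iff.1 hT₂
  rw [← projClass_prod, ← projClass_prod, projClass_eq_iff] at hT
  obtain ⟨β⟩ := hT
  let e₀ : (Q × P) ≃ₗ[S] (X₁ × X₂) × (Y₁ × Y₂) :=
    (Submodule.prodEquivOfIsCompl X₁ X₂ hX).symm.prodCongr
      (Submodule.prodEquivOfIsCompl Y₁ Y₂ hY).symm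
  have hX₁ : ∀ a : Q × P, (e₀ a).1.1 = 0 ↔ a.1 ∈ X₂ := fun a =>
    Submodule.prodEquivOfIsCompl_symm_apply_fst_eq_zero X₁ X₂ hX
  have hX₂ : ∀ a : Q × P, (e₀ a).1.2 = 0 ↔ a.1 ∈ X₁ := fun a =>
    Submodule.prodEquivOfIsCompl_symm_apply_snd_eq_zero X₁ X₂ hX
  have hY₁ : ∀ a : Q × P, (e₀ a).2.1 = 0 ↔ a.2 ∈ Y₂ := fun a =>
    Submodule.prodEquivOfIsCompl_symm_apply_fst_eq_zero Y₁ Y₂ hY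
  have hY₂ : ∀ a : Q × P, (e₀ a).2.2 = 0 ↔ a.2 ∈ Y₁ := fun a =>
    Submodule.prodEquivOfIsCompl_symm_apply_snd_eq_zero Y₁ Y₂ hY
  have h₂ : ShearReachable (X₁.prod Y₁) (X₂.prod Y₂) := by
    refine ShearReachable.coordinates.double_swap
      (e₀.trans ((δ.prodCongr (.refl S X₂)).prodCongr ((LinearEquiv.refl S Y₁).prodCongr α)))
      β (fun a => ?_) (fun a => ?_) fun a => ?_
    · exact ((Submodule.prodEquivOfIsCompl Y₁ Y₂ hY).symm.trans
        ((LinearEquiv.refl S Y₁).prodCongr α)).map_eq_zero_iff.symm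
    · exact (and_congr (hX₂ a) (α.map_eq_zero_iff.trans (hY₂ a))).symm
    · exact (and_congr (δ.map_eq_zero_iff.trans (hX₁ a)) (hY₁ a)).symm
  have h₃ : IsCompl (LinearMap.ker (LinearMap.snd S Q P ∘ₗ θ.toLinearMap)) (LinearMap.ker π) := by
    refine Submodule.isCompl_of_forall_sub_mem (fun a ha hb => ?_) fun a =>
      ⟨θ.symm ((θ a).1, 0), by simp, by simp [π]⟩
    exact θ.map_eq_zero_iff.1 (Prod.ext hb ha)
  exact (h₂.replace_right hcompl).replace_left h₃

end Elementary

/-! ### Block diagonalization of regular endomorphisms -/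

section BlockDiagonal

variable {S : Type u} [Ring S]

section

variable {M K I : Type u} [AddCommGroup M] [Module S M] [AddCommGroup K] [Module S K]
  [AddCommGroup I] [Module S I]

theorem LinearEquiv.projective_fst [Module.Projective S M] (e : M ≃ₗ[S] K × I) :
    Module.Projective S K :=
  .of_split (e.symm.toLinearMap ∘ₗ LinearMap.inl S K I) (LinearMap.fst S K I ∘ₗ e.toLinearMap)
    (by ext; simp)

theorem LinearEquiv.finite_fst [Module.Finite S M] (e : M ≃ₗ[S] K × I) : Module.Finite S K :=
  .of_surjective (LinearMap.fst S K I ∘ₗ e.toLinearMap) fun k => ⟨e.symm (k, 0), by simp⟩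

/-- A regular endomorphism is the identity of a common summand, up to the choice of decompositions
of its domain and of its codomain. -/
theorem LinearMap.exists_equiv_prod_of_regular {f g : M →ₗ[S] M} (h : ∀ a, f (g (f a)) = f a) :
    ∃ (e₁ : M ≃ₗ[S] LinearMap.ker f × LinearMap.range f)
      (e₂ : M ≃ₗ[S] LinearMap.ker (f ∘ₗ g) × LinearMap.range f),
      ∀ a, e₂ (f a) = (0, (e₁ a).2) := by
  have h' : ∀ y : LinearMap.range f, f (g y) = y := by
    rintro ⟨_, a, rfl⟩
    exact h a
  refine ⟨
    { toFun a := (⟨a - g (f a), by simp [h]⟩, ⟨f a, a, rfl⟩)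
      invFun b := b.1 + g b.2
      map_add' a b := by ext <;> simp; abel
      map_smul' r a := by ext <;> simp [smul_sub]
      left_inv a := by simp
      right_inv b := ?_ },
    { toFun a := (⟨a - f (g a), by simp [h]⟩, ⟨f (g a), _, rfl⟩)
      invFun b := b.1 + b.2
      map_add' a b := by ext <;> simp; abel
      map_smul' r a := by ext <;> simp [smul_sub]
      left_inv a := by simp
      right_inv b := ?_ }, fun a => ?_⟩
  · have h₀ : f b.1 = 0 := b.1.2
    ext <;> simp [h₀, h']
  · have h₀ : f (g b.1) = 0 := b.1.2
    ext <;> simp [h₀, h']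
  · ext <;> simp [h]

end

variable {Q P : Type u} [AddCommGroup Q] [Module S Q] [AddCommGroup P] [Module S P]
  [Module.Finite S Q] [Module.Projective S Q] [Module.Finite S P] [Module.Projective S P]

/-- Compatible splittings of the kernel, the cokernel and the image of a regular endomorphism make
it block diagonal with respect to suitable automorphisms of its domain and of its codomain. -/
theorem exists_equiv_block_diagonal (href : HasRefinement (ProjClass S))
    (hsep : IsSeparative (ProjClass S)) (hPQ : Below (projClass S P) (projClass S Q))
    {f : (Q × P) →ₗ[S] (Q × P)} {K L I : Type u} [AddCommGroup K] [Module S K] [AddCommGroup L]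
    [Module S L] [AddCommGroup I] [Module S I] (e₁ : (Q × P) ≃ₗ[S] K × I)
    (e₂ : (Q × P) ≃ₗ[S] L × I) (he : ∀ a, e₂ (f a) = (0, (e₁ a).2)) :
    ∃ θ₁ θ₂ : (Q × P) ≃ₗ[S] (Q × P), ∀ a,
      ((θ₁ a).2 = 0 → (θ₂ (f a)).2 = 0) ∧ ((θ₁ a).1 = 0 → (θ₂ (f a)).1 = 0) := by
  have := e₁.projective_fst
  have := e₁.finite_fst
  have := e₂.projective_fst
  have := e₂.finite_fst
  have := (e₁.trans (.prodComm S K I)).projective_fst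
  have := (e₁.trans (.prodComm S K I)).finite_fst
  obtain ⟨k₁, k₂, i₁, i₂, l₁, l₂, hK, hI, hL, h₁, h₂, h₃, h₄⟩ :=
    hsep.exists_compatible_splitting href (k := projClass S K) (i := projClass S I)
      (l := projClass S L) (u := projClass S Q) (v := projClass S P)
      (projClass_eq e₁.symm) (projClass_eq e₂.symm) hPQ
  induction k₁ using ProjClass.ind with | h K₁ => ?_
  induction k₂ using ProjClass.ind with | h K₂ => ?_
  induction i₁ using ProjClass.ind with | h I₁ => ?_
  induction i₂ using ProjClass.ind with | h I₂ => ?_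
  induction l₁ using ProjClass.ind with | h L₁ => ?_
  induction l₂ using ProjClass.ind with | h L₂ => ?_
  obtain ⟨κ⟩ := projClass_eq_add_iff.1 hK
  obtain ⟨ι⟩ := projClass_eq_add_iff.1 hI
  obtain ⟨μ⟩ := projClass_eq_add_iff.1 hL
  obtain ⟨q₁⟩ := projClass_eq_add_iff.1 h₁.symm
  obtain ⟨q₂⟩ := projClass_eq_add_iff.1 h₂.symm
  obtain ⟨p₁⟩ := projClass_eq_add_iff.1 h₃.symm
  obtain ⟨p₂⟩ := projClass_eq_add_iff.1 h₄.symm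
  let θ₁ : (Q × P) ≃ₗ[S] (Q × P) := (e₁.trans (κ.prodCongr ι)).trans
    ((LinearEquiv.prodProdProdComm S K₁ K₂ I₁ I₂).trans (q₁.symm.prodCongr p₁.symm))
  let θ₂ : (Q × P) ≃ₗ[S] (Q × P) := (e₂.trans (μ.prodCongr ι)).trans
    ((LinearEquiv.prodProdProdComm S L₁ L₂ I₁ I₂).trans (q₂.symm.prodCongr p₂.symm))
  have hq : ∀ a, (θ₁ a).1 = q₁.symm ((κ (e₁ a).1).1, (ι (e₁ a).2).1) := fun _ => rfl
  have hp : ∀ a, (θ₁ a).2 = p₁.symm ((κ (e₁ a).1).2, (ι (e₁ a).2).2) := fun _ => rfl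
  have hq' : ∀ a, (θ₂ a).1 = q₂.symm ((μ (e₂ a).1).1, (ι (e₂ a).2).1) := fun _ => rfl
  have hp' : ∀ a, (θ₂ a).2 = p₂.symm ((μ (e₂ a).1).2, (ι (e₂ a).2).2) := fun _ => rfl
  refine ⟨θ₁, θ₂, fun a => ⟨fun h => ?_, fun h => ?_⟩⟩
  · rw [hp, LinearEquiv.map_eq_zero_iff, Prod.mk_eq_zero] at h
    rw [hp', he, h.2, map_zero, Prod.snd_zero, Prod.mk_zero_zero, map_zero]
  · rw [hq, LinearEquiv.map_eq_zero_iff, Prod.mk_eq_zero] at h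
    rw [hq', he, h.2, map_zero, Prod.fst_zero, Prod.mk_zero_zero, map_zero]

/-- A regular endomorphism of `Q × P` becomes block diagonal after multiplication by products of
shears on both sides. -/
theorem exists_shear_block_diagonal (hS : HasInvariantSections S S)
    (hsep : IsSeparative (ProjClass S)) (hPQ : Below (projClass S P) (projClass S Q))
    (hQP : Below (projClass S Q) (projClass S P)) {f g : (Q × P) →ₗ[S] (Q × P)}
    (hfg : ∀ a, f (g (f a)) = f a) :
    ∃ g₁ ∈ shearGroup S Q P, ∃ g₂ ∈ shearGroup S Q P, ∀ a,
      (a.2 = 0 → (g₂ (f (g₁ a))).2 = 0) ∧ (a.1 = 0 → (g₂ (f (g₁ a))).1 = 0) := by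
  obtain ⟨e₁, e₂, he⟩ := LinearMap.exists_equiv_prod_of_regular hfg
  obtain ⟨θ₁, θ₂, hθ⟩ := exists_equiv_block_diagonal (hasRefinement_projClass hS) hsep hPQ e₁ e₂ he
  obtain ⟨g₁, hg₁, h₁⟩ := exists_shear_diagonalizing hS hsep hQP θ₁
  obtain ⟨g₂, hg₂, h₂⟩ := exists_shear_diagonalizing hS hsep hQP θ₂
  have h₃ : ∀ b, g₂ (g₂⁻¹ b) = b := g₂.apply_symm_apply
  refine ⟨g₁, hg₁, g₂⁻¹, inv_mem hg₂, fun a => ⟨fun ha => ?_, fun ha => ?_⟩⟩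
  · rw [← (h₂ _).1, h₃]
    exact (hθ _).1 ((h₁ a).1.2 ha)
  · rw [← (h₂ _).2, h₃]
    exact (hθ _).2 ((h₁ a).2.2 ha)

end BlockDiagonal

/-! ### Elementary operations on matrices -/

section Matrices

open Matrix

variable {R : Type u} [Ring R] {n : ℕ}

/-- `G` is invertible, and multiplication by `G` on either side is a composite of elementary
operations. -/
def ActsElementarily (G : Matrix (Fin n) (Fin n) R) : Prop :=
  IsUnit G ∧ ∀ A, Relation.ReflTransGen ElementaryOperation A (G * A) ∧
    Relation.ReflTransGen ElementaryOperation A (A * G)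

theorem ActsElementarily.one : ActsElementarily (1 : Matrix (Fin n) (Fin n) R) :=
  ⟨isUnit_one, fun A => by rw [one_mul, mul_one]; exact ⟨.refl, .refl⟩⟩

theorem ActsElementarily.mul {G H : Matrix (Fin n) (Fin n) R} (hG : ActsElementarily G)
    (hH : ActsElementarily H) : ActsElementarily (G * H) := by
  refine ⟨hG.1.mul hH.1, fun A => ?_⟩
  rw [Matrix.mul_assoc G H A, ← Matrix.mul_assoc A G H]
  exact ⟨(hH.2 A).1.trans (hG.2 _).1, (hG.2 A).2.trans (hH.2 _).2⟩

theorem Matrix.one_add_single_mul_one_add_single_neg {i j : Fin n} (hij : i ≠ j) (r : R) :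
    (1 + Matrix.single i j r) * (1 + Matrix.single i j (-r)) = 1 := by
  rw [add_mul, one_mul, mul_add, mul_one, Matrix.single_mul_single_of_ne _ _ _ _ hij.symm,
    add_zero, add_assoc, ← Matrix.single_add, neg_add_cancel, Matrix.single_zero, add_zero]

theorem ActsElementarily.one_add_single {i j : Fin n} (hij : i ≠ j) (r : R) :
    ActsElementarily (1 + Matrix.single i j r) := by
  refine ⟨⟨⟨_, _, one_add_single_mul_one_add_single_neg hij r,
    by simpa using one_add_single_mul_one_add_single_neg hij (-r)⟩, rfl⟩, fun A => ?_⟩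
  constructor
  · convert Relation.ReflTransGen.single (ElementaryOperation.row (A := A) i j hij r) using 1
    ext k l
    rw [add_mul, one_mul, Matrix.add_apply, updateRow_apply]
    split_ifs with h
    · subst h; simp
    · simp [h]
  · convert Relation.ReflTransGen.single (ElementaryOperation.col (A := A) j i hij.symm r) using 1
    ext k l
    rw [mul_add, mul_one, Matrix.add_apply, updateCol_apply]
    split_ifs with h
    · subst h; simp
    · simp [h]

theorem ActsElementarily.one_add_sum_single_right {j : Fin n} (c : Fin n → R) (s : Finset (Fin n))
    (hs : j ∉ s) : ActsElementarily (1 + ∑ i ∈ s, Matrix.single i j (c i)) := by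
  induction s using Finset.induction_on with
  | empty => simpa using ActsElementarily.one
  | insert i s hi ih =>
    rw [Finset.mem_insert, not_or] at hs
    have h := (ih hs.2).mul (.one_add_single (Ne.symm hs.1) (c i))
    have e : (∑ k ∈ s, Matrix.single k j (c k)) * Matrix.single i j (c i) = 0 := by
      rw [Finset.sum_mul]
      exact Finset.sum_eq_zero fun k _ => Matrix.single_mul_single_of_ne _ _ _ _ hs.1 _
    rw [add_mul, one_mul, mul_add, mul_one, e, add_zero] at h
    rwa [Finset.sum_insert hi, ← add_assoc]

theorem ActsElementarily.one_add_sum_single_left {i : Fin n} (c : Fin n → R) (s : Finset (Fin n))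
    (hs : i ∉ s) : ActsElementarily (1 + ∑ j ∈ s, Matrix.single i j (c j)) := by
  induction s using Finset.induction_on with
  | empty => simpa using ActsElementarily.one
  | insert j s hj ih =>
    rw [Finset.mem_insert, not_or] at hs
    have h := (ActsElementarily.one_add_single hs.1 (c j)).mul (ih hs.2)
    have e : Matrix.single i j (c j) * (∑ k ∈ s, Matrix.single i k (c k)) = 0 := by
      rw [Finset.mul_sum]
      exact Finset.sum_eq_zero fun k _ =>
        Matrix.single_mul_single_of_ne _ _ _ _ (Ne.symm hs.1) _
    rw [add_mul, one_mul, mul_add, mul_one, e, add_zero] at h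
    rw [Finset.sum_insert hj]
    convert h using 1
    abel

/-- The right `R`-linear endomorphism `v ↦ A *ᵥ v` of `Rⁿ`. -/
def Matrix.mulVecRight (A : Matrix (Fin n) (Fin n) R) :
    (Fin n → R) →ₗ[Rᵐᵒᵖ] (Fin n → R) where
  toFun v := A *ᵥ v
  map_add' := A.mulVec_add
  map_smul' r v := A.mulVec_smul r v

@[simp]
theorem Matrix.mulVecRight_apply (A : Matrix (Fin n) (Fin n) R) (v : Fin n → R) :
    A.mulVecRight v = A *ᵥ v := rfl

/-- The splitting `R^(n+1) ≃ R × Rⁿ` of right modules. -/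
def splitHead (R : Type u) [Ring R] (n : ℕ) : (R × (Fin n → R)) ≃ₗ[Rᵐᵒᵖ] (Fin (n + 1) → R) :=
  Fin.consLinearEquiv Rᵐᵒᵖ fun _ => R

theorem splitHead_apply (a : R × (Fin n → R)) :
    splitHead R n a = Fin.cons a.1 a.2 := rfl

theorem exists_actsElementarily_shearSnd (ψ : R →ₗ[Rᵐᵒᵖ] (Fin n → R)) :
    ∃ G : Matrix (Fin (n + 1)) (Fin (n + 1)) R, ActsElementarily G ∧
      ∀ a, splitHead R n (ψ.shearSnd a) = G *ᵥ splitHead R n a := by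
  refine ⟨_, .one_add_sum_single_right (j := 0) (Fin.cons 0 (ψ 1)) (Finset.univ.erase 0) (by simp),
    fun a => ?_⟩
  have h : ∀ q i, ψ q i = ψ 1 i * q := fun q i => by
    simpa using congrFun (ψ.map_smul (MulOpposite.op q) 1) i
  ext k
  rw [add_mulVec, one_mulVec, Matrix.sum_mulVec]
  refine Fin.cases ?_ (fun k => ?_) k
  · simp [splitHead_apply, single_mulVec, Fin.sum_univ_succ,
      (Fin.succ_ne_zero _).symm]
  · simp [splitHead_apply, single_mulVec, h a.1 k, Fin.sum_univ_succ, Function.update_apply]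

theorem exists_actsElementarily_shearFst (φ : (Fin n → R) →ₗ[Rᵐᵒᵖ] R) :
    ∃ G : Matrix (Fin (n + 1)) (Fin (n + 1)) R, ActsElementarily G ∧
      ∀ a, splitHead R n (φ.shearFst a) = G *ᵥ splitHead R n a := by
  refine ⟨_, .one_add_sum_single_left (i := 0) (Fin.cons 0 fun j => φ (Pi.single j 1))
    (Finset.univ.erase 0) (by simp), fun a => ?_⟩
  have h : ∀ p, φ p = ∑ j, φ (Pi.single j 1) * p j := fun p => by
    conv_lhs => rw [← Finset.univ_sum_single p]
    rw [map_sum]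
    refine Finset.sum_congr rfl fun j _ => ?_
    rw [← op_smul_eq_mul, ← φ.map_smul, ← Pi.single_smul]
    simp
  ext k
  rw [add_mulVec, one_mulVec, Matrix.sum_mulVec]
  refine Fin.cases ?_ (fun k => ?_) k
  · simp [splitHead_apply, single_mulVec, h a.2, Fin.sum_univ_succ]
  · simp [splitHead_apply, single_mulVec]

theorem exists_actsElementarily_of_mem_shearGroup
    {g : (R × (Fin n → R)) ≃ₗ[Rᵐᵒᵖ] (R × (Fin n → R))} (hg : g ∈ shearGroup Rᵐᵒᵖ R (Fin n → R)) :
    ∃ G : Matrix (Fin (n + 1)) (Fin (n + 1)) R, ActsElementarily G ∧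
      ∀ a, splitHead R n (g a) = G *ᵥ splitHead R n a := by
  let p : ((R × (Fin n → R)) ≃ₗ[Rᵐᵒᵖ] (R × (Fin n → R))) → Prop := fun g =>
    ∃ G : Matrix (Fin (n + 1)) (Fin (n + 1)) R, ActsElementarily G ∧
      ∀ a, splitHead R n (g a) = G *ᵥ splitHead R n a
  suffices h : p g ∧ p g⁻¹ from h.1
  induction hg using Subgroup.closure_induction with
  | mem g hg =>
    rcases hg with ⟨φ, rfl⟩ | ⟨ψ, rfl⟩
    · have e : φ.shearFst⁻¹ = (-φ).shearFst :=
        LinearEquiv.ext fun a => Prod.ext (sub_eq_add_neg _ _) rfl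
      exact ⟨exists_actsElementarily_shearFst φ, e ▸ exists_actsElementarily_shearFst (-φ)⟩
    · have e : ψ.shearSnd⁻¹ = (-ψ).shearSnd :=
        LinearEquiv.ext fun a => Prod.ext rfl (sub_eq_add_neg _ _)
      exact ⟨exists_actsElementarily_shearSnd ψ, e ▸ exists_actsElementarily_shearSnd (-ψ)⟩
  | one =>
    rw [inv_one]
    have h : p 1 := ⟨1, .one, fun a => by simp⟩
    exact ⟨h, h⟩
  | mul g h _ _ hg hh =>
    have key : ∀ {g h}, p g → p h → p (g * h) := by
      rintro g h ⟨G, hG, eG⟩ ⟨H, hH, eH⟩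
      exact ⟨G * H, hG.mul hH, fun a => by
        rw [LinearEquiv.mul_apply, eG, eH, mulVec_mulVec]⟩
    rw [_root_.mul_inv_rev]
    exact ⟨key hg.1 hh.1, key hh.2 hg.2⟩
  | inv g _ hg => exact ⟨hg.2, (inv_inv g).symm ▸ hg.1⟩

/-- The block diagonal matrix with blocks `b` and `A`. -/
def Matrix.consDiag (b : R) (A : Matrix (Fin n) (Fin n) R) : Matrix (Fin (n + 1)) (Fin (n + 1)) R :=
  of (Fin.cons (Fin.cons b 0) fun i => Fin.cons 0 (A i))

theorem ElementaryOperation.consDiag (b : R) {A B : Matrix (Fin n) (Fin n) R}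
    (h : ElementaryOperation A B) :
    ElementaryOperation (Matrix.consDiag b A) (Matrix.consDiag b B) := by
  cases h with
  | row i j hij r =>
    convert ElementaryOperation.row (A := Matrix.consDiag b A) i.succ j.succ
      (by simpa using hij) r using 1
    ext k l
    refine Fin.cases ?_ (fun k => ?_) k
    · simp [Matrix.consDiag, updateRow_apply, (Fin.succ_ne_zero i).symm]
    · refine Fin.cases ?_ (fun l => ?_) l <;>
        simp [Matrix.consDiag, updateRow_apply]
  | col i j hij r =>
    convert ElementaryOperation.col (A := Matrix.consDiag b A) i.succ j.succ
      (by simpa using hij) r using 1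
    ext k l
    refine Fin.cases ?_ (fun l => ?_) l
    · refine Fin.cases ?_ (fun k => ?_) k <;>
        simp [Matrix.consDiag, (Fin.succ_ne_zero i).symm]
    · refine Fin.cases ?_ (fun k => ?_) k <;>
        simp [Matrix.consDiag, updateCol_apply]

theorem Matrix.IsDiag.consDiag (b : R) {A : Matrix (Fin n) (Fin n) R} (hA : A.IsDiag) :
    (Matrix.consDiag b A).IsDiag := by
  intro i j
  refine Fin.cases (Fin.cases ?_ (fun j => ?_) j) (fun i => Fin.cases ?_ (fun j => ?_) j) i
  · simp
  · simp [Matrix.consDiag]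
  · simp [Matrix.consDiag]
  · intro hij
    simpa [Matrix.consDiag] using hA (fun h => hij (congrArg Fin.succ h))

theorem IsVonNeumannRegular.of_consDiag {b : R} {A : Matrix (Fin n) (Fin n) R}
    (h : IsVonNeumannRegular (Matrix.consDiag b A)) : IsVonNeumannRegular A := by
  obtain ⟨X, hX⟩ := h
  refine ⟨X.submatrix Fin.succ Fin.succ, ?_⟩
  ext i j
  have := congrFun (congrFun hX i.succ) j.succ
  simpa [Matrix.mul_apply, Fin.sum_univ_succ, Matrix.consDiag] using this

theorem IsVonNeumannRegular.mul_isUnit {M : Type u} [Monoid M] {a g h : M}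
    (ha : IsVonNeumannRegular a) (hg : IsUnit g) (hh : IsUnit h) :
    IsVonNeumannRegular (g * a * h) := by
  obtain ⟨x, hx⟩ := ha
  obtain ⟨g, rfl⟩ := hg
  obtain ⟨h, rfl⟩ := hh
  refine ⟨↑h⁻¹ * x * ↑g⁻¹, ?_⟩
  calc _ = g * (a * x * a) * h := by simp [mul_assoc]
    _ = _ := by rw [hx]

/-- `R` is isomorphic to `Rᵐᵒᵖ` as a right `R`-module. -/
def rightSelfEquiv (R : Type u) [Ring R] : R ≃ₗ[Rᵐᵒᵖ] Rᵐᵒᵖ where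
  toFun := MulOpposite.op
  invFun := MulOpposite.unop
  map_add' _ _ := rfl
  map_smul' _ _ := rfl
  left_inv _ := rfl
  right_inv _ := rfl

/-- A regular matrix of size at least two can be transformed by elementary operations into a block
diagonal matrix with a block of size one. -/
theorem exists_consDiag_of_regular (hexch : IsExchangeRing R) (hsep : IsSeparativeRing R)
    {A : Matrix (Fin (n + 2)) (Fin (n + 2)) R} (hA : IsVonNeumannRegular A) :
    ∃ (b : R) (B : Matrix (Fin (n + 1)) (Fin (n + 1)) R), IsVonNeumannRegular B ∧
      Relation.ReflTransGen ElementaryOperation A (Matrix.consDiag b B) := by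
  have hS : HasInvariantSections Rᵐᵒᵖ Rᵐᵒᵖ :=
    (HasFiniteExchange.hasInvariantSections hexch).of_equiv (rightSelfEquiv R)
  have : Module.Finite Rᵐᵒᵖ R := .equiv (rightSelfEquiv R).symm
  have : Module.Projective Rᵐᵒᵖ R := .of_equiv (rightSelfEquiv R).symm
  have hV : IsSeparative (ProjClass Rᵐᵒᵖ) := isSeparative_projClass fun P Q => hsep P Q
  have h₁ : Below (projClass Rᵐᵒᵖ (Fin (n + 1) → R)) (projClass Rᵐᵒᵖ R) :=
    projClass_pi_fin (S := Rᵐᵒᵖ) (P := R) (n + 1) ▸ Below.nsmul _ _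
  have h₂ : Below (projClass Rᵐᵒᵖ R) (projClass Rᵐᵒᵖ (Fin (n + 1) → R)) := by
    rw [projClass_pi_fin, succ_nsmul]
    exact .right _ _
  obtain ⟨X, hX⟩ := hA
  let κ := splitHead R (n + 1)
  let f := κ.symm.toLinearMap ∘ₗ A.mulVecRight ∘ₗ κ.toLinearMap
  let g := κ.symm.toLinearMap ∘ₗ X.mulVecRight ∘ₗ κ.toLinearMap
  have hfg : ∀ a, f (g (f a)) = f a := fun a => by
    simp [f, g, Matrix.mulVec_mulVec, ← Matrix.mul_assoc, hX]
  obtain ⟨g₁, hg₁, g₂, hg₂, h⟩ := exists_shear_block_diagonal hS hV h₁ h₂ hfg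
  obtain ⟨G₁, hG₁, e₁⟩ := exists_actsElementarily_of_mem_shearGroup hg₁
  obtain ⟨G₂, hG₂, e₂⟩ := exists_actsElementarily_of_mem_shearGroup hg₂
  have e : ∀ a, κ (g₂ (f (g₁ a))) = (G₂ * A * G₁) *ᵥ κ a := fun a => by
    rw [e₂]
    change G₂ *ᵥ κ (κ.symm (A *ᵥ κ (g₁ a))) = _
    rw [LinearEquiv.apply_symm_apply, e₁, mulVec_mulVec, mulVec_mulVec, Matrix.mul_assoc]
  have hrow : ∀ j : Fin (n + 1), (G₂ * A * G₁) 0 j.succ = 0 := fun j => by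
    have h₀ : κ (g₂ (f (g₁ (0, Pi.single j 1)))) 0 = 0 := (h (0, Pi.single j 1)).2 rfl
    have h₁ : κ (0, Pi.single j 1) = Pi.single j.succ 1 := by
      ext k
      refine Fin.cases ?_ (fun k => ?_) k <;>
        simp [κ, splitHead_apply, Pi.single_apply, (Fin.succ_ne_zero _).symm]
    rw [e, h₁, mulVec_single_one] at h₀
    exact h₀
  have hcol : ∀ i : Fin (n + 1), (G₂ * A * G₁) i.succ 0 = 0 := fun i => by
    have h₀ : κ (g₂ (f (g₁ (1, 0)))) i.succ = 0 := congrFun ((h (1, 0)).1 rfl) i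
    have h₁ : κ (1, 0) = Pi.single 0 1 := by
      ext k
      refine Fin.cases ?_ (fun k => ?_) k <;> simp [κ, splitHead_apply]
    rw [e, h₁, mulVec_single_one] at h₀
    exact h₀
  have hB : G₂ * A * G₁ = Matrix.consDiag ((G₂ * A * G₁) 0 0)
      ((G₂ * A * G₁).submatrix Fin.succ Fin.succ) := by
    ext i j
    refine Fin.cases (Fin.cases ?_ (fun j => ?_) j) (fun i => Fin.cases ?_ (fun j => ?_) j) i
    · rfl
    · exact hrow j
    · exact hcol i
    · rfl
  refine ⟨(G₂ * A * G₁) 0 0, (G₂ * A * G₁).submatrix Fin.succ Fin.succ,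
    .of_consDiag (hB ▸ IsVonNeumannRegular.mul_isUnit ⟨X, hX⟩ hG₂.1 hG₁.1), ?_⟩
  rw [← hB]
  exact (hG₂.2 A).1.trans (hG₁.2 _).2

end Matrices

theorem theorem2p10 {R : Type u} [Ring R] (hexch : IsExchangeRing R) (hsep : IsSeparativeRing R)
    (n : ℕ) (A : Matrix (Fin n) (Fin n) R) (hA : IsVonNeumannRegular A) :
    ∃ D : Matrix (Fin n) (Fin n) R, Relation.ReflTransGen ElementaryOperation A D ∧ D.IsDiag := by
  match n with
  | 0 => exact ⟨A, .refl, fun i => i.elim0⟩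
  | 1 => exact ⟨A, .refl, fun i j hij => (hij (Subsingleton.elim i j)).elim⟩
  | n + 2 =>
    obtain ⟨b, B, hB, h⟩ := exists_consDiag_of_regular hexch hsep hA
    -- The block of size one stays fixed while the other block is diagonalized.
    obtain ⟨D, hD, hdiag⟩ := theorem2p10 hexch hsep (n + 1) B hB
    exact ⟨Matrix.consDiag b D,
      h.trans (hD.lift _ fun _ _ hCD => hCD.consDiag b), hdiag.consDiag b⟩
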